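/- For a real number $s\ge 0$ let $$H^s(\mathbb R)=\Big\{u\in L^2(\mathbb R;\mathbb C)\;:\;\|u\|_{H^s}^2:=\int_{\mathbb R}\big(1+|\xi|^{2s}\big)\,|\hat u(\xi)|^2\,d\xi<\infty\Big\},\qquad \hat u(\xi)=\frac1{\sqrt{2\pi}}\int_{\mathbb R}u(y)\,e^{-iy\xi}\,dy$$ (the Fourier transform being extended to $L^2$). A sequence $(\psi_n)$ in $H^s(\mathbb R)$ is called vanishing if for every sequence $(x_n)$ of real numbers the sequence of translates $\psi_n(\cdot-x_n)$ converges to $0$ weakly in $H^s(\mathbb R)$. Let $s\ge\frac12$ and let $(\psi_n)$ be a vanishing sequence in $H^s(\mathbb R)$. Then for every real number $p>2$ each $\psi_n$ belongs to $L^p(\mathbb R)$ and $\|\psi_n\|_{L^p(\mathbb R)}\to 0$ as $n\to\infty$. -/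

import Mathlib

open MeasureTheory Filter Topology FourierTransform
open scoped ENNReal

namespace FracSobolev

noncomputable section

/-- The square root of the weight `1 + |η|^{2s}` at the angular frequency `η = 2πξ`. Mathlib's
Fourier transform is `∫ e^{-2πixξ} u(x) dx`; with the normalisation
`(2π)^{-1/2} ∫ e^{-ixη} u(x) dx` of `û` one has
`∫ (1 + |η|^{2s}) |û(η)|² dη = ∫ (1 + |2πξ|^{2s}) |𝓕 u(ξ)|² dξ`. -/
def weight (s ξ : ℝ) : ℝ := Real.sqrt (1 + |2 * Real.pi * ξ| ^ (2 * s))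

lemma weight_pos (s ξ : ℝ) : 0 < weight s ξ :=
  Real.sqrt_pos.2 (by positivity)

lemma weight_sq (s ξ : ℝ) : weight s ξ ^ 2 = 1 + |2 * Real.pi * ξ| ^ (2 * s) :=
  Real.sq_sqrt (by positivity)

/-- The subspace of all `u ∈ L²(ℝ, ℂ)` with `∫ (1 + |2πξ|^{2s}) |𝓕 u(ξ)|² dξ < ∞`, where `𝓕` is
the `L²` Fourier transform. -/
def sobolevSubmodule (s : ℝ) : Submodule ℂ (Lp ℂ 2 (volume : Measure ℝ)) where
  carrier := {u | MemLp (fun ξ => (weight s ξ : ℂ) * (𝓕 u : Lp ℂ 2 (volume : Measure ℝ)) ξ) 2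
    (volume : Measure ℝ)}
  zero_mem' := by
    have h : (𝓕 (0 : Lp ℂ 2 (volume : Measure ℝ)) : Lp ℂ 2 (volume : Measure ℝ)) = 0 :=
      (Lp.fourierTransformₗᵢ ℝ ℂ).map_zero
    simp only [Set.mem_ofPred_eq, h]
    refine MemLp.ae_eq (f := 0) ?_ MemLp.zero
    filter_upwards [Lp.coeFn_zero ℂ 2 (volume : Measure ℝ)] with ξ hξ
    rw [hξ, Pi.zero_apply, mul_zero]
  add_mem' := by
    intro u v hu hv
    simp only [Set.mem_ofPred_eq] at *
    rw [FourierAdd.fourier_add]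
    refine (hu.add hv).ae_eq ?_
    filter_upwards [Lp.coeFn_add (𝓕 u : Lp ℂ 2 (volume : Measure ℝ)) (𝓕 v)] with ξ hξ
    rw [hξ]
    simp [mul_add]
  smul_mem' := by
    intro c u hu
    simp only [Set.mem_ofPred_eq] at *
    rw [FourierSMul.fourier_smul]
    refine (hu.const_smul c).ae_eq ?_
    filter_upwards [Lp.coeFn_smul c (𝓕 u : Lp ℂ 2 (volume : Measure ℝ))] with ξ hξ
    rw [hξ]
    simp [mul_left_comm]

/-- The Sobolev space `H^s(ℝ)` of complex-valued functions, for a real order `s ≥ 0`. It is a type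
of its own, since its norm is not the one it inherits from `L²`. -/
def Hs (s : ℝ) : Type := sobolevSubmodule s

namespace Hs

variable {s : ℝ}

instance : AddCommGroup (Hs s) := inferInstanceAs (AddCommGroup (sobolevSubmodule s))

instance : Module ℂ (Hs s) := inferInstanceAs (Module ℂ (sobolevSubmodule s))

/-- The inclusion `H^s(ℝ) ⊆ L²(ℝ)`. -/
def toL2 : Hs s →ₗ[ℂ] Lp ℂ 2 (volume : Measure ℝ) := (sobolevSubmodule s).subtype

/-- An element of `H^s(ℝ)` as a function, determined almost everywhere. -/
instance : CoeFun (Hs s) (fun _ => ℝ → ℂ) := ⟨fun u => (toL2 u : ℝ → ℂ)⟩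

lemma memLp_weight (u : Hs s) :
    MemLp (fun ξ => (weight s ξ : ℂ) * (𝓕 (toL2 u) : Lp ℂ 2 (volume : Measure ℝ)) ξ) 2
      (volume : Measure ℝ) := u.2

/-- The map `u ↦ (1 + |2πξ|^{2s})^{1/2} 𝓕 u` from `H^s` to `L²`, from which `H^s` takes its norm. -/
def weightedFourier : Hs s →ₗ[ℂ] Lp ℂ 2 (volume : Measure ℝ) where
  toFun u := (memLp_weight u).toLp _
  map_add' := by
    intro u v
    rw [← MemLp.toLp_add]
    apply MemLp.toLp_congr
    rw [map_add, FourierAdd.fourier_add]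
    filter_upwards [Lp.coeFn_add (𝓕 (toL2 u) : Lp ℂ 2 (volume : Measure ℝ)) (𝓕 (toL2 v))]
      with ξ hξ
    rw [hξ]
    simp [mul_add]
  map_smul' := by
    intro c u
    rw [RingHom.id_apply, ← MemLp.toLp_const_smul]
    apply MemLp.toLp_congr
    rw [map_smul, FourierSMul.fourier_smul]
    filter_upwards [Lp.coeFn_smul c (𝓕 (toL2 u) : Lp ℂ 2 (volume : Measure ℝ))] with ξ hξ
    rw [hξ]
    simp [mul_left_comm]

lemma weightedFourier_ae (u : Hs s) :
    weightedFourier u =ᵐ[volume]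
      fun ξ => (weight s ξ : ℂ) * (𝓕 (toL2 u) : Lp ℂ 2 (volume : Measure ℝ)) ξ :=
  (memLp_weight u).coeFn_toLp

lemma weightedFourier_injective :
    Function.Injective (weightedFourier : Hs s → Lp ℂ 2 (volume : Measure ℝ)) := by
  refine (injective_iff_map_eq_zero weightedFourier).2 fun u hu => ?_
  have h1 := weightedFourier_ae u
  rw [hu] at h1
  have h2 : (𝓕 (toL2 u) : Lp ℂ 2 (volume : Measure ℝ)) = 0 := by
    refine Lp.ext ?_
    filter_upwards [h1, Lp.coeFn_zero ℂ 2 (volume : Measure ℝ)] with ξ h h0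
    rw [h0] at h ⊢
    have hw : (weight s ξ : ℂ) ≠ 0 := by exact_mod_cast (weight_pos s ξ).ne'
    simpa [hw] using h.symm
  have h3 : toL2 u = 0 := by
    apply (Lp.fourierTransformₗᵢ ℝ ℂ).injective
    rw [map_zero]
    exact h2
  exact Subtype.ext h3

instance : NormedAddCommGroup (Hs s) :=
  NormedAddCommGroup.induced (Hs s) (Lp ℂ 2 (volume : Measure ℝ)) weightedFourier
    weightedFourier_injective

instance : NormedSpace ℂ (Hs s) :=
  NormedSpace.induced ℂ (Hs s) (Lp ℂ 2 (volume : Measure ℝ)) weightedFourier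

/-- The norm of `H^s`: `‖u‖² = ∫ (1 + |2πξ|^{2s}) |𝓕 u(ξ)|² dξ`. -/
theorem norm_sq_eq (u : Hs s) :
    ‖u‖ ^ 2 = ∫ ξ : ℝ, (1 + |2 * Real.pi * ξ| ^ (2 * s)) *
      ‖(𝓕 (toL2 u) : Lp ℂ 2 (volume : Measure ℝ)) ξ‖ ^ 2 := by
  have h : ‖u‖ = ‖weightedFourier u‖ := rfl
  have h2 := L2.inner_def (𝕜 := ℂ) (weightedFourier u) (weightedFourier u)
  rw [inner_self_eq_norm_sq_to_K] at h2
  have h3 : (((‖weightedFourier u‖ ^ 2 : ℝ)) : ℂ) =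
      ((∫ ξ, ‖weightedFourier u ξ‖ ^ 2 : ℝ) : ℂ) := by
    rw [← integral_complex_ofReal]
    simpa [inner_self_eq_norm_sq_to_K] using h2
  rw [h, Complex.ofReal_injective h3]
  refine integral_congr_ae ?_
  filter_upwards [weightedFourier_ae u] with ξ hξ
  rw [hξ, ← weight_sq, norm_mul, mul_pow, Complex.norm_real, Real.norm_eq_abs, sq_abs]

end Hs

/-- The translation `u ↦ u(· - a)` on `L²(ℝ)`. -/
def translateL2 (a : ℝ) (u : Lp ℂ 2 (volume : Measure ℝ)) : Lp ℂ 2 (volume : Measure ℝ) :=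
  Lp.compMeasurePreserving (fun x => x - a) (measurePreserving_sub_right volume a) u

lemma translateL2_ae (a : ℝ) (u : Lp ℂ 2 (volume : Measure ℝ)) :
    translateL2 a u =ᵐ[volume] fun x => u (x - a) :=
  Lp.coeFn_compMeasurePreserving u (measurePreserving_sub_right volume a)

lemma memLp_modulation (a : ℝ) :
    MemLp (fun ξ : ℝ => ((Real.fourierChar (-(a * ξ)) : Circle) : ℂ)) ⊤ (volume : Measure ℝ) := by
  refine memLp_top_of_bound (Continuous.aestronglyMeasurable (by fun_prop)) 1 ?_
  filter_upwards with ξ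
  exact (Circle.norm_coe _).le

/-- `𝓕 (u(· - a)) = e^{-2πiaξ} 𝓕 u` on `L²(ℝ)`. -/
lemma fourier_translateL2_ae (a : ℝ) (u : Lp ℂ 2 (volume : Measure ℝ)) :
    (𝓕 (translateL2 a u) : Lp ℂ 2 (volume : Measure ℝ)) =ᵐ[volume]
      fun ξ => ((Real.fourierChar (-(a * ξ)) : Circle) : ℂ) *
        (𝓕 u : Lp ℂ 2 (volume : Measure ℝ)) ξ := by
  set M : Lp ℂ ⊤ (volume : Measure ℝ) := (memLp_modulation a).toLp _ with hM
  set B := (ContinuousLinearMap.mul ℂ ℂ).holderL (volume : Measure ℝ) ⊤ 2 2 M with hB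
  have hBae : ∀ v : Lp ℂ 2 (volume : Measure ℝ), B v =ᵐ[volume]
      fun ξ => ((Real.fourierChar (-(a * ξ)) : Circle) : ℂ) * v ξ := by
    intro v
    have h := (ContinuousLinearMap.mul ℂ ℂ).coeFn_holder (r := 2) M v
    filter_upwards [h, (memLp_modulation a).coeFn_toLp] with ξ h1 h2
    rw [← h2]
    exact h1
  have key : (𝓕 (translateL2 a u) : Lp ℂ 2 (volume : Measure ℝ)) = B (𝓕 u) := by
    refine DenseRange.induction_on
      (p := fun u : Lp ℂ 2 (volume : Measure ℝ) =>
        (𝓕 (translateL2 a u) : Lp ℂ 2 (volume : Measure ℝ)) = B (𝓕 u))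
      (SchwartzMap.denseRange_toLpCLM (E := ℝ) (F := ℂ) (p := 2) (μ := volume)
        ENNReal.ofNat_ne_top) u ?_ ?_
    · have hF : Continuous (fun u : Lp ℂ 2 (volume : Measure ℝ) =>
          (𝓕 u : Lp ℂ 2 (volume : Measure ℝ))) := (Lp.fourierTransformₗᵢ ℝ ℂ).continuous
      have hT : Continuous (translateL2 a) :=
        (Lp.isometry_compMeasurePreserving (measurePreserving_sub_right volume a)).continuous
      exact isClosed_eq (hF.comp hT) (B.continuous.comp hF)
    · intro f
      have h1 : translateL2 a (f.toLp 2) = (f.compSubConstCLM ℂ a).toLp 2 := by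
        refine Lp.ext ?_
        have hq := (measurePreserving_sub_right (volume : Measure ℝ) a).quasiMeasurePreserving.ae_eq_comp
          (f.coeFn_toLp 2 volume)
        filter_upwards [translateL2_ae a (f.toLp 2), (f.compSubConstCLM ℂ a).coeFn_toLp 2 volume, hq]
          with x hx1 hx2 hx3
        rw [hx1, hx2]
        simpa using hx3
      change (𝓕 (translateL2 a (f.toLp 2)) : Lp ℂ 2 (volume : Measure ℝ)) = B (𝓕 (f.toLp 2))
      rw [h1, SchwartzMap.toLp_fourier_eq, SchwartzMap.toLp_fourier_eq]
      refine Lp.ext ?_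
      filter_upwards [hBae ((𝓕 f).toLp 2), (𝓕 f).coeFn_toLp 2 volume,
        (𝓕 (f.compSubConstCLM ℂ a)).coeFn_toLp 2 volume] with ξ h1 h2 h3
      rw [h1, h2, h3, SchwartzMap.fourier_coe, SchwartzMap.fourier_coe]
      have := VectorFourier.fourierIntegral_comp_add_right Real.fourierChar (volume : Measure ℝ)
        (innerₗ ℝ) (f : ℝ → ℂ) (-a)
      have h4 := congrFun this ξ
      simp only [Function.comp_def, ← sub_eq_add_neg] at h4
      refine h4.trans ?_
      simp [Circle.smul_def, mul_comm]
      rfl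
  rw [key]
  exact hBae _

namespace Hs

variable {s : ℝ}

/-- The translation `u ↦ u(· - a)` on `H^s(ℝ)`. -/
def translate (a : ℝ) (u : Hs s) : Hs s :=
  ⟨translateL2 a (toL2 u), by
    refine (memLp_weight u).of_le (g := fun ξ => (weight s ξ : ℂ) *
      (𝓕 (toL2 u) : Lp ℂ 2 (volume : Measure ℝ)) ξ) ?_ ?_
    · exact (Measurable.aestronglyMeasurable (by unfold weight; fun_prop)).mul (Lp.aestronglyMeasurable _)
    · filter_upwards [fourier_translateL2_ae a (toL2 u)] with ξ hξ
      rw [hξ, norm_mul, norm_mul, norm_mul, Circle.norm_coe, one_mul]⟩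

lemma translate_ae (a : ℝ) (u : Hs s) :
    (translate a u : ℝ → ℂ) =ᵐ[volume] fun x => u (x - a) :=
  translateL2_ae a (toL2 u)

/-- A sequence `ψ` in `H^s(ℝ)` is vanishing if for every sequence `x` of reals the translated
sequence `ψ n (· - x n)` converges to `0` weakly in `H^s(ℝ)`, that is, in the topology that the
continuous linear functionals on `H^s(ℝ)` induce. -/
def IsVanishing (ψ : ℕ → Hs s) : Prop :=
  ∀ x : ℕ → ℝ, Tendsto (fun n => toWeakSpace ℂ (Hs s) (translate (x n) (ψ n))) atTop (𝓝 0)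

end Hs

end

end FracSobolev

/-! Fix a frequency level `R` and split each `ψ n` into the frequencies `|ξ| ≤ R` and the rest. The
high part is small in `L^p` uniformly in `n`: for `|ξ| > R ≥ 1` and `s ≥ 1/2` one has `|ξ|^(1-2/p) ≤
R^(-2/p) |ξ| ≤ R^(-2/p) (weight s ξ)^2`, so the homogeneous Sobolev inequality
`lintegral_rpow_le_of_fourier` bounds the `p`-th power of its norm by a multiple of `R⁻¹`.
Uniformity comes from boundedness of `ψ` in `H^s`, a consequence of weak convergence. The low part
at `x` is one fixed continuous functional applied to the translate of `ψ n` by `-x`. Vanishing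
permits any choice of translations, so this tends to `0` uniformly in `x`; interpolating the sup
bound with the `L²` bound gives smallness in `L^p`. The Sobolev inequality is proved by the
layer-cake formula with a frequency cut-off depending on the height `t`: the low frequencies
contribute at most `t/2` pointwise, and Chebyshev and Plancherel handle the others. -/

namespace FracSobolev

noncomputable section

/-! ### Fourier inversion and frequency truncation -/

/-- On `L¹ ∩ L²` the inverse `L²` Fourier transform is given by the inverse Fourier integral. -/
lemma fourierInv_ae_eq_of_integrable (G : Lp ℂ 2 (volume : Measure ℝ))
    (hG : Integrable (G : ℝ → ℂ)) :
    (𝓕⁻ G : Lp ℂ 2 (volume : Measure ℝ)) =ᵐ[volume] 𝓕⁻ (G : ℝ → ℂ) := by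
  have hcont : Continuous (𝓕⁻ (G : ℝ → ℂ)) := by
    rw [Real.fourierInv_eq_fourier_comp_neg]
    exact VectorFourier.fourierIntegral_continuous Real.continuous_fourierChar
      (innerSL ℝ).continuous₂ hG.comp_neg
  -- Both sides are tested against smooth compactly supported `g`: the `L²` transform moves onto `g`
  -- by duality of tempered distributions, the integral by Fubini.
  refine ae_eq_of_integral_contDiff_smul_eq ((Lp.memLp _).locallyIntegrable one_le_two)
    hcont.locallyIntegrable fun g g_smooth g_cpt => ?_
  have hg₁ : HasCompactSupport (Complex.ofRealCLM ∘ g) := g_cpt.comp_left rfl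
  have hg₂ : ContDiff ℝ (⊤ : ℕ∞) (Complex.ofRealCLM ∘ g) :=
    Complex.ofRealCLM.contDiff.comp g_smooth
  set φ := hg₁.toSchwartzMap hg₂ with hφ
  have h1 := DFunLike.congr_fun (Lp.fourierInv_toTemperedDistribution_eq G) φ
  rw [TemperedDistribution.fourierInv_apply, Lp.toTemperedDistribution_apply,
    Lp.toTemperedDistribution_apply] at h1
  have h2 : ∫ x, φ x • (𝓕⁻ (G : ℝ → ℂ)) x = ∫ ξ, (𝓕⁻ φ) ξ • G ξ := by
    have hL : ∀ (L : ℝ →ₗ[ℝ] ℝ →ₗ[ℝ] ℝ) (h : ℝ → ℂ), (∀ x ξ, L x ξ = -(x * ξ)) →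
        VectorFourier.fourierIntegral Real.fourierChar volume L h = 𝓕⁻ h := by
      intro L h hL
      ext ξ
      simp [VectorFourier.fourierIntegral, Real.fourierInv_eq, hL, mul_comm]
    -- The sign in `-innerₗ ℝ` turns the forward transform into the inverse one.
    have h3 := VectorFourier.integral_fourierIntegral_smul_eq_flip (L := -innerₗ ℝ)
      (μ := volume) (ν := volume) (e := Real.fourierChar) Real.continuous_fourierChar
      (by simpa using (by fun_prop : Continuous fun q : ℝ × ℝ => -(q.2 * q.1))) φ.integrable hG
    rw [hL _ _ (by simp [mul_comm]), hL _ _ (by simp)] at h3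
    rw [SchwartzMap.fourierInv_coe]
    exact h3.symm
  calc _ = ∫ x, φ x • (𝓕⁻ G : Lp ℂ 2 (volume : Measure ℝ)) x := by simp [hφ]
    _ = ∫ x, φ x • (𝓕⁻ (G : ℝ → ℂ)) x := by rw [h2, h1]
    _ = _ := by simp [hφ]

/-- The restriction of `u ∈ L²` to the frequencies in `S`. -/
def freqRestrict {S : Set ℝ} (hS : MeasurableSet S) (u : Lp ℂ 2 (volume : Measure ℝ)) :
    Lp ℂ 2 (volume : Measure ℝ) :=
  𝓕⁻ (((Lp.memLp (𝓕 u : Lp ℂ 2 (volume : Measure ℝ))).indicator hS).toLp _)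

variable {S : Set ℝ} (hS : MeasurableSet S) (u : Lp ℂ 2 (volume : Measure ℝ))

lemma fourier_freqRestrict_ae :
    (𝓕 (freqRestrict hS u) : Lp ℂ 2 (volume : Measure ℝ)) =ᵐ[volume]
      S.indicator (𝓕 u : Lp ℂ 2 (volume : Measure ℝ)) := by
  rw [freqRestrict, fourier_fourierInv_eq]
  exact MemLp.coeFn_toLp _

lemma freqRestrict_add_compl : freqRestrict hS u + freqRestrict hS.compl u = u := by
  apply (Lp.fourierTransformₗᵢ ℝ ℂ).injective
  change (𝓕 (freqRestrict hS u + freqRestrict hS.compl u) : Lp ℂ 2 (volume : Measure ℝ)) = 𝓕 u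
  rw [FourierAdd.fourier_add]
  refine Lp.ext ?_
  filter_upwards [fourier_freqRestrict_ae hS u, fourier_freqRestrict_ae hS.compl u,
    Lp.coeFn_add (𝓕 (freqRestrict hS u) : Lp ℂ 2 (volume : Measure ℝ))
      (𝓕 (freqRestrict hS.compl u))] with ξ h1 h2 h3
  rw [h3, Pi.add_apply, h1, h2, ← Pi.add_apply, Set.indicator_self_add_compl]

/-- On a set of finite measure an `L²` function is integrable, so the inversion integral converges
absolutely. -/
lemma freqRestrict_ae (hSv : volume S ≠ ⊤) :
    freqRestrict hS u =ᵐ[volume] fun x => ∫ ξ in S, ((Real.fourierChar (x * ξ) : Circle) : ℂ) *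
      (𝓕 u : Lp ℂ 2 (volume : Measure ℝ)) ξ := by
  have hcoe := ((Lp.memLp (𝓕 u : Lp ℂ 2 (volume : Measure ℝ))).indicator hS).coeFn_toLp
  have hint : Integrable (S.indicator (𝓕 u : Lp ℂ 2 (volume : Measure ℝ))) :=
    (integrable_indicator_iff hS).2
      (integrableOn_Lp_of_measure_ne_top _ fact_one_le_two_ennreal.elim hSv)
  filter_upwards [fourierInv_ae_eq_of_integrable _ (hint.congr hcoe.symm)] with x hx
  rw [freqRestrict, hx, Real.fourierInv_congr_ae hcoe, Real.fourierInv_eq,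
    ← integral_indicator hS]
  congr 1 with ξ
  by_cases h : ξ ∈ S <;> simp [h, Circle.smul_def, mul_comm]

lemma lintegral_enorm_sq_eq :
    ∫⁻ x, ‖u x‖ₑ ^ (2 : ℝ) = ENNReal.ofReal (‖u‖ ^ 2) := by
  rw [← Real.rpow_two, ← ENNReal.ofReal_rpow_of_nonneg (norm_nonneg _) two_pos.le, ofReal_norm,
    Lp.enorm_def, eLpNorm_eq_lintegral_rpow_enorm_toReal two_ne_zero ENNReal.ofNat_ne_top,
    ← ENNReal.rpow_mul]
  simp

lemma lintegral_enorm_sq_fourier :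
    ∫⁻ ξ, ‖(𝓕 u : Lp ℂ 2 (volume : Measure ℝ)) ξ‖ₑ ^ (2 : ℝ) = ∫⁻ x, ‖u x‖ₑ ^ (2 : ℝ) := by
  rw [lintegral_enorm_sq_eq, lintegral_enorm_sq_eq, Lp.norm_fourier_eq]

lemma lintegral_enorm_sq_freqRestrict :
    ∫⁻ x, ‖freqRestrict hS u x‖ₑ ^ (2 : ℝ) =
      ∫⁻ ξ in S, ‖(𝓕 u : Lp ℂ 2 (volume : Measure ℝ)) ξ‖ₑ ^ (2 : ℝ) := by
  rw [← lintegral_enorm_sq_fourier, ← lintegral_indicator hS]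
  refine lintegral_congr_ae ?_
  filter_upwards [fourier_freqRestrict_ae hS u] with ξ hξ
  rw [hξ]
  by_cases h : ξ ∈ S <;> simp [h]

/-! ### The homogeneous Sobolev inequality -/

lemma lintegral_Ioo_rpow {a r : ℝ} (ha : 0 ≤ a) (hr : -1 < r) :
    ∫⁻ t in Set.Ioo 0 a, ENNReal.ofReal (t ^ r) = ENNReal.ofReal (a ^ (r + 1) / (r + 1)) := by
  have hi : IntegrableOn (fun t : ℝ => t ^ r) (Set.Ioc 0 a) :=
    (intervalIntegrable_iff_integrableOn_Ioc_of_le ha).1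
      (intervalIntegral.intervalIntegrable_rpow' hr)
  rw [setLIntegral_congr Ioo_ae_eq_Ioc, ← ofReal_integral_eq_lintegral_ofReal hi,
    ← intervalIntegral.integral_of_le ha, integral_rpow (Or.inl hr),
    Real.zero_rpow (by linarith), sub_zero]
  filter_upwards [ae_restrict_mem measurableSet_Ioc] with t ht
  exact Real.rpow_nonneg ht.1.le _

lemma lintegral_abs_rpow {a r : ℝ} (ha : 0 ≤ a) (hr : -1 < r) :
    ∫⁻ t in {t : ℝ | |t| ≤ a}, ENNReal.ofReal (|t| ^ r) =
      ENNReal.ofReal (2 * (a ^ (r + 1) / (r + 1))) := by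
  have hset : {t : ℝ | |t| ≤ a} =ᵐ[volume] (Set.Ioo (-a) 0 ∪ Set.Ioo 0 a : Set ℝ) := by
    have h0 : ∀ᵐ t : ℝ, t ≠ 0 ∧ t ≠ a ∧ t ≠ -a := by
      filter_upwards [Measure.ae_ne volume (0 : ℝ), Measure.ae_ne volume a,
        Measure.ae_ne volume (-a)] with t h1 h2 h3 using ⟨h1, h2, h3⟩
    filter_upwards [h0] with t ht
    apply propext
    change |t| ≤ a ↔ (-a < t ∧ t < 0) ∨ (0 < t ∧ t < a)
    rw [abs_le]
    grind
  have hneg : ∫⁻ t in Set.Ioo (-a) 0, ENNReal.ofReal (|t| ^ r) =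
      ∫⁻ t in Set.Ioo 0 a, ENNReal.ofReal (|t| ^ r) := by
    have := (Measure.measurePreserving_neg (volume : Measure ℝ)).setLIntegral_comp_preimage_emb
      (MeasurableEquiv.neg ℝ).measurableEmbedding
      (fun t : ℝ => ENNReal.ofReal (|t| ^ r)) (Set.Ioo 0 a)
    simpa using this
  have hpos : ∫⁻ t in Set.Ioo 0 a, ENNReal.ofReal (|t| ^ r) =
      ENNReal.ofReal (a ^ (r + 1) / (r + 1)) := by
    rw [← lintegral_Ioo_rpow ha hr]
    refine setLIntegral_congr_fun measurableSet_Ioo fun t ht => ?_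
    simp only [abs_of_pos ht.1]
  have hr' : 0 ≤ a ^ (r + 1) / (r + 1) := div_nonneg (Real.rpow_nonneg ha _) (by linarith)
  rw [setLIntegral_congr hset, lintegral_union measurableSet_Ioo, hneg, hpos,
    ← ENNReal.ofReal_add hr' hr', two_mul]
  rw [Set.disjoint_left]
  intro t h1 h2
  exact lt_asymm h1.2 h2.1

/-- The low frequencies of `u` are controlled by a homogeneous Sobolev norm. -/
lemma lintegral_abs_le_enorm_le {g : ℝ → ℂ} (hg : AEStronglyMeasurable g) {p : ℝ} (hp : 0 < p)
    {K A : ℝ} (hK : 0 ≤ K) (hA : 0 ≤ A)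
    (hgK : ∫⁻ ξ, ENNReal.ofReal (|ξ| ^ (1 - 2 / p)) * ‖g ξ‖ₑ ^ (2 : ℝ) ≤ ENNReal.ofReal K) :
    ∫⁻ ξ in {ξ : ℝ | |ξ| ≤ A}, ‖g ξ‖ₑ ≤ ENNReal.ofReal (Real.sqrt (p * K) * A ^ (1 / p)) := by
  -- Cauchy–Schwarz with reciprocal weights: `w` goes with `g`, and `w'` is square integrable on
  -- `|ξ| ≤ A` because `2 (1/p - 1/2) = 2/p - 1 > -1`.
  set w : ℝ → ℝ≥0∞ := fun ξ => ENNReal.ofReal (|ξ| ^ (1 / 2 - 1 / p)) with hw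
  set w' : ℝ → ℝ≥0∞ := fun ξ => ENNReal.ofReal (|ξ| ^ (1 / p - 1 / 2)) with hw'
  have hm : ∀ r : ℝ, Measurable fun ξ : ℝ => ENNReal.ofReal (|ξ| ^ r) := by
    intro r; fun_prop
  have hsq : ∀ r ξ : ℝ, ENNReal.ofReal (|ξ| ^ r) ^ (2 : ℝ) = ENNReal.ofReal (|ξ| ^ (2 * r)) := by
    intro r ξ
    rw [ENNReal.ofReal_rpow_of_nonneg (by positivity) two_pos.le, ← Real.rpow_mul (abs_nonneg _),
      mul_comm]
  have h1 : ∫⁻ ξ in {ξ : ℝ | |ξ| ≤ A}, ‖g ξ‖ₑ =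
      ∫⁻ ξ in {ξ : ℝ | |ξ| ≤ A}, (w' * fun ξ => w ξ * ‖g ξ‖ₑ) ξ := by
    refine lintegral_congr_ae (ae_restrict_of_ae ?_)
    filter_upwards [Measure.ae_ne volume (0 : ℝ)] with ξ hξ
    have : 0 < |ξ| := abs_pos.2 hξ
    rw [Pi.mul_apply, ← mul_assoc, hw, hw', ← ENNReal.ofReal_mul (by positivity),
      ← Real.rpow_add this]
    simp
  have h2 := ENNReal.lintegral_mul_le_Lp_mul_Lq (volume.restrict {ξ : ℝ | |ξ| ≤ A})
    Real.HolderConjugate.two_two (hm (1 / p - 1 / 2)).aemeasurable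
    (((hm (1 / 2 - 1 / p)).aemeasurable.mul hg.enorm).restrict)
  rw [h1]
  refine h2.trans ?_
  have h3 : ∫⁻ ξ in {ξ : ℝ | |ξ| ≤ A}, ENNReal.ofReal (|ξ| ^ (1 / p - 1 / 2)) ^ (2 : ℝ) =
      ENNReal.ofReal (p * A ^ (2 / p)) := by
    simp_rw [hsq]
    rw [lintegral_abs_rpow hA (by ring_nf; simp [hp])]
    congr 1
    have : 2 * (1 / p - 1 / 2) + 1 = 2 / p := by ring
    rw [this]
    field_simp
  have h4 : ∫⁻ ξ in {ξ : ℝ | |ξ| ≤ A},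
      (ENNReal.ofReal (|ξ| ^ (1 / 2 - 1 / p)) * ‖g ξ‖ₑ) ^ (2 : ℝ) ≤ ENNReal.ofReal K := by
    refine (setLIntegral_le_lintegral _ _).trans (le_trans (le_of_eq ?_) hgK)
    refine lintegral_congr fun ξ => ?_
    rw [ENNReal.mul_rpow_of_nonneg _ _ two_pos.le, hsq]
    ring_nf
  calc _ ≤ ENNReal.ofReal (p * A ^ (2 / p)) ^ (1 / 2 : ℝ) * ENNReal.ofReal K ^ (1 / 2 : ℝ) :=
        mul_le_mul' (le_of_eq (by rw [← h3])) (ENNReal.rpow_le_rpow h4 (by norm_num))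
    _ = _ := by
      rw [ENNReal.ofReal_rpow_of_nonneg (by positivity) (by norm_num),
        ENNReal.ofReal_rpow_of_nonneg hK (by norm_num), ← ENNReal.ofReal_mul (by positivity)]
      congr 1
      rw [Real.sqrt_eq_rpow, Real.mul_rpow hp.le (by positivity), Real.mul_rpow hp.le hK,
        ← Real.rpow_mul hA]
      ring_nf

/-- The constant in the homogeneous Sobolev inequality. -/
def sobolevConst (p : ℝ) : ℝ := 4 * p / (p - 2) * (2 * Real.sqrt p) ^ (p - 2)

/-- Where `‖u‖ > t` and the low part is at most `t/2`, the high part is at least `t/2`; Chebyshev's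
inequality and Plancherel finish. -/
lemma volume_lt_norm_le (u : Lp ℂ 2 (volume : Measure ℝ)) {A t : ℝ} (ht : 0 < t)
    (hlow : ∫⁻ ξ in {ξ : ℝ | |ξ| ≤ A}, ‖(𝓕 u : Lp ℂ 2 (volume : Measure ℝ)) ξ‖ₑ ≤
      ENNReal.ofReal (t / 2)) :
    volume {x | t < ‖u x‖} ≤ ENNReal.ofReal (4 / t ^ 2) *
      ∫⁻ ξ in {ξ : ℝ | |ξ| ≤ A}ᶜ, ‖(𝓕 u : Lp ℂ 2 (volume : Measure ℝ)) ξ‖ₑ ^ (2 : ℝ) := by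
  have hS : MeasurableSet {ξ : ℝ | |ξ| ≤ A} := measurableSet_le (by fun_prop) (by fun_prop)
  have hSv : volume {ξ : ℝ | |ξ| ≤ A} ≠ ⊤ := by
    have : {ξ : ℝ | |ξ| ≤ A} = Set.Icc (-A) A := by ext; simp [abs_le]
    simp [this]
  have hlowx : ∀ᵐ x, ‖freqRestrict hS u x‖ ≤ t / 2 := by
    filter_upwards [freqRestrict_ae hS u hSv] with x hx
    rw [← ENNReal.ofReal_le_ofReal_iff (by positivity), ofReal_norm, hx]
    refine (enorm_integral_le_lintegral_enorm _).trans (le_trans (le_of_eq ?_) hlow)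
    refine lintegral_congr fun ξ => ?_
    rw [enorm_mul, ← ofReal_norm, Circle.norm_coe, ENNReal.ofReal_one, one_mul]
  have hadd : ∀ᵐ x, u x = freqRestrict hS u x + freqRestrict hS.compl u x := by
    conv => enter [1, x, 1]; rw [← freqRestrict_add_compl hS u]
    exact Lp.coeFn_add _ _
  have hsub : {x | t < ‖u x‖} ≤ᵐ[volume]
      {x | ENNReal.ofReal ((t / 2) ^ 2) ≤ ‖freqRestrict hS.compl u x‖ₑ ^ (2 : ℝ)} := by
    filter_upwards [hlowx, hadd] with x h1 h2 (h3 : t < ‖u x‖)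
    have h4 : t / 2 ≤ ‖freqRestrict hS.compl u x‖ := by
      have := norm_add_le (freqRestrict hS u x) (freqRestrict hS.compl u x)
      rw [← h2] at this
      linarith
    change ENNReal.ofReal ((t / 2) ^ 2) ≤ ‖freqRestrict hS.compl u x‖ₑ ^ (2 : ℝ)
    rw [← ofReal_norm, ENNReal.ofReal_rpow_of_nonneg (norm_nonneg _) two_pos.le, Real.rpow_two]
    exact ENNReal.ofReal_le_ofReal (by gcongr)
  refine (measure_mono_ae hsub).trans ?_
  refine (meas_ge_le_lintegral_div ((Lp.aestronglyMeasurable _).enorm.pow_const _)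
    (by simp; positivity) ENNReal.ofReal_ne_top).trans (le_of_eq ?_)
  rw [lintegral_enorm_sq_freqRestrict, ENNReal.div_eq_inv_mul,
    ← ENNReal.ofReal_inv_of_pos (by positivity)]
  congr 2
  field_simp
  norm_num

/-- The homogeneous Sobolev inequality `‖u‖_p ≤ C ‖|ξ|^{1/2 - 1/p} 𝓕 u‖₂` on the line. -/
lemma lintegral_rpow_le_of_fourier (u : Lp ℂ 2 (volume : Measure ℝ)) {p K : ℝ} (hp : 2 < p)
    (hK : 0 < K)
    (huK : ∫⁻ ξ, ENNReal.ofReal (|ξ| ^ (1 - 2 / p)) *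
      ‖(𝓕 u : Lp ℂ 2 (volume : Measure ℝ)) ξ‖ₑ ^ (2 : ℝ) ≤ ENNReal.ofReal K) :
    ∫⁻ x, ‖u x‖ₑ ^ p ≤ ENNReal.ofReal (sobolevConst p * K ^ (p / 2)) := by
  set g := ((𝓕 u : Lp ℂ 2 (volume : Measure ℝ)) : ℝ → ℂ) with hg
  have hgm : AEStronglyMeasurable g := Lp.aestronglyMeasurable _
  have hp0 : 0 < p := by linarith
  set M := Real.sqrt (p * K) with hM
  have hM0 : 0 < M := by positivity
  have hmeas : ∀ t ∈ Set.Ioi (0 : ℝ), volume {x | t < ‖u x‖} * ENNReal.ofReal (t ^ (p - 1)) ≤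
      ∫⁻ ξ, ENNReal.ofReal 4 * ((if t < 2 * M * |ξ| ^ (1 / p) then
        ENNReal.ofReal (t ^ (p - 3)) else 0) * ‖g ξ‖ₑ ^ (2 : ℝ)) := by
    intro t (ht : 0 < t)
    -- The cut-off `A` solves `M * A^(1/p) = t/2`, so the low frequencies contribute at most half
    -- the height.
    have hlow := lintegral_abs_le_enorm_le hgm hp0 hK.le
      (A := (t / (2 * M)) ^ p) (by positivity) huK
    rw [← Real.rpow_mul (by positivity), mul_one_div_cancel hp0.ne', Real.rpow_one, ← hM,
      show M * (t / (2 * M)) = t / 2 by field_simp] at hlow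
    refine (mul_le_mul_left (volume_lt_norm_le u ht hlow) _).trans (le_of_eq ?_)
    have hS : MeasurableSet {ξ : ℝ | |ξ| ≤ (t / (2 * M)) ^ p} :=
      measurableSet_le (by fun_prop) (by fun_prop)
    rw [← lintegral_indicator hS.compl, mul_right_comm, ← ENNReal.ofReal_mul (by positivity),
      ← lintegral_const_mul'' _ (by
        exact (hgm.enorm.pow_const _).indicator hS.compl)]
    refine lintegral_congr fun ξ => ?_
    -- The condition `|ξ| > A` is rewritten as an upper bound on `t`, ready for integrating in `t`
    -- first.
    have hiff : t < 2 * M * |ξ| ^ (1 / p) ↔ ξ ∈ {ξ : ℝ | |ξ| ≤ (t / (2 * M)) ^ p}ᶜ := by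
      simp only [Set.mem_compl_iff, Set.mem_ofPred_eq, not_le]
      rw [one_div, ← div_lt_iff₀' (by positivity),
        Real.lt_rpow_inv_iff_of_pos (by positivity) (abs_nonneg _) hp0]
    by_cases h : ξ ∈ {ξ : ℝ | |ξ| ≤ (t / (2 * M)) ^ p}ᶜ
    · rw [if_pos (hiff.2 h), Set.indicator_of_mem h, ← mul_assoc,
        ← ENNReal.ofReal_mul (by norm_num)]
      congr 2
      rw [show p - 1 = p - 3 + (2 : ℕ) by push_cast; ring, Real.rpow_add ht, Real.rpow_natCast]
      field_simp
    · rw [if_neg (mt hiff.1 h), Set.indicator_of_notMem h]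
      simp
  -- The integral of `t^(p-3)` converges at `0` because `p > 2`; its value involves `|ξ|^((p-2)/p)`,
  -- which is exactly the weight in the hypothesis.
  have hinner : ∀ ξ, ∫⁻ t in Set.Ioi (0 : ℝ), ENNReal.ofReal 4 *
      ((if t < 2 * M * |ξ| ^ (1 / p) then
        ENNReal.ofReal (t ^ (p - 3)) else 0) * ‖g ξ‖ₑ ^ (2 : ℝ)) =
      ENNReal.ofReal (4 * ((2 * M) ^ (p - 2) / (p - 2))) *
        (ENNReal.ofReal (|ξ| ^ (1 - 2 / p)) * ‖g ξ‖ₑ ^ (2 : ℝ)) := by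
    intro ξ
    have hm : Measurable fun t : ℝ => if t < 2 * M * |ξ| ^ (1 / p) then
        ENNReal.ofReal (t ^ (p - 3)) else 0 :=
      Measurable.ite (measurableSet_lt (by fun_prop) (by fun_prop)) (by fun_prop) (by fun_prop)
    rw [lintegral_const_mul _ (hm.mul_const _), lintegral_mul_const _ hm]
    have h1 : ∫⁻ t in Set.Ioi (0 : ℝ), (if t < 2 * M * |ξ| ^ (1 / p) then
        ENNReal.ofReal (t ^ (p - 3)) else 0) =
        ∫⁻ t in Set.Ioo 0 (2 * M * |ξ| ^ (1 / p)), ENNReal.ofReal (t ^ (p - 3)) := by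
      rw [← lintegral_indicator measurableSet_Ioi, ← lintegral_indicator measurableSet_Ioo]
      refine lintegral_congr fun t => ?_
      simp only [Set.indicator, Set.mem_Ioi, Set.mem_Ioo]
      split_ifs <;> first | rfl | (exfalso; tauto)
    rw [h1, lintegral_Ioo_rpow (by positivity) (by linarith), ← mul_assoc, ← mul_assoc,
      ← ENNReal.ofReal_mul (by norm_num), ← ENNReal.ofReal_mul
        (mul_nonneg (by norm_num) (div_nonneg (by positivity) (by linarith)))]
    congr 2
    rw [show p - 3 + 1 = p - 2 by ring, Real.mul_rpow (by positivity) (by positivity),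
      ← Real.rpow_mul (abs_nonneg _), show 1 / p * (p - 2) = 1 - 2 / p by field_simp]
    ring
  have hswap : AEMeasurable (Function.uncurry fun (t ξ : ℝ) => ENNReal.ofReal 4 *
      ((if t < 2 * M * |ξ| ^ (1 / p) then
        ENNReal.ofReal (t ^ (p - 3)) else 0) * ‖g ξ‖ₑ ^ (2 : ℝ)))
      ((volume.restrict (Set.Ioi 0)).prod volume) := by
    have h1 : Measurable fun q : ℝ × ℝ => if q.1 < 2 * M * |q.2| ^ (1 / p) then
        ENNReal.ofReal (q.1 ^ (p - 3)) else 0 :=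
      Measurable.ite (measurableSet_lt (by fun_prop) (by fun_prop)) (by fun_prop) (by fun_prop)
    have h2 : AEMeasurable (fun q : ℝ × ℝ => ‖g q.2‖ₑ ^ (2 : ℝ))
        ((volume.restrict (Set.Ioi 0)).prod volume) :=
      (hgm.enorm.pow_const (2 : ℝ)).comp_snd
    exact (h1.aemeasurable.mul h2).const_mul _
  -- Since `M` is a multiple of `K^(1/2)`, the factor `M^(p-2) * K` scales as `K^(p/2)`.
  have hfin : (ENNReal.ofReal p * (ENNReal.ofReal (4 * ((2 * M) ^ (p - 2) / (p - 2))) *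
      ENNReal.ofReal K)) = ENNReal.ofReal (sobolevConst p * K ^ (p / 2)) := by
    have hp2 : 0 < p - 2 := by linarith
    rw [← ENNReal.ofReal_mul (by positivity), ← ENNReal.ofReal_mul hp0.le]
    congr 1
    rw [hM, Real.sqrt_mul hp0.le, ← mul_assoc 2, Real.mul_rpow (by positivity) (by positivity),
      sobolevConst, Real.sqrt_eq_rpow K, ← Real.rpow_mul hK.le,
      show p / 2 = 1 / 2 * (p - 2) + 1 by ring, Real.rpow_add hK, Real.rpow_one]
    ring
  calc ∫⁻ x, ‖u x‖ₑ ^ p = ∫⁻ x, ENNReal.ofReal (‖u x‖ ^ p) := by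
        refine lintegral_congr fun x => ?_
        rw [← ofReal_norm, ENNReal.ofReal_rpow_of_nonneg (norm_nonneg _) hp0.le]
    _ = ENNReal.ofReal p * ∫⁻ t in Set.Ioi 0,
        volume {x | t < ‖u x‖} * ENNReal.ofReal (t ^ (p - 1)) :=
      lintegral_rpow_eq_lintegral_meas_lt_mul volume (ae_of_all _ fun _ => norm_nonneg _)
        (Lp.aestronglyMeasurable u).norm.aemeasurable hp0
    _ ≤ _ := mul_le_mul_right (setLIntegral_mono' measurableSet_Ioi hmeas) _
    _ = ENNReal.ofReal p * ∫⁻ ξ, ENNReal.ofReal (4 * ((2 * M) ^ (p - 2) / (p - 2))) *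
        (ENNReal.ofReal (|ξ| ^ (1 - 2 / p)) * ‖g ξ‖ₑ ^ (2 : ℝ)) := by
      rw [lintegral_lintegral_swap hswap]
      simp_rw [hinner]
    _ ≤ _ := by
      rw [lintegral_const_mul' _ _ ENNReal.ofReal_ne_top, ← hfin]
      gcongr

/-! ### Vanishing sequences: boundedness and uniform decay of low frequencies -/

namespace Hs

variable {s : ℝ}

lemma translate_zero (u : Hs s) : translate 0 u = u := by
  refine Subtype.ext (Lp.ext ?_)
  filter_upwards [translate_ae 0 u] with x hx
  exact hx.trans (by rw [sub_zero]; rfl)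

lemma IsVanishing.tendsto_apply {ψ : ℕ → Hs s} (hψ : IsVanishing ψ) (x : ℕ → ℝ)
    (f : StrongDual ℂ (Hs s)) : Tendsto (fun n => f (translate (x n) (ψ n))) atTop (𝓝 0) := by
  have hf : Continuous fun v : WeakSpace ℂ (Hs s) => f ((toWeakSpace ℂ (Hs s)).symm v) :=
    WeakBilin.eval_continuous _ f
  have h := (hf.tendsto 0).comp (hψ x)
  rw [map_zero, map_zero] at h
  exact h

/-- Zero translations give a weakly convergent sequence. Uniform boundedness applies to its image in
the double dual, whose elements act on the complete space `StrongDual ℂ (Hs s)`. -/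
lemma IsVanishing.exists_norm_le {ψ : ℕ → Hs s} (hψ : IsVanishing ψ) : ∃ C, ∀ n, ‖ψ n‖ ≤ C := by
  obtain ⟨C, hC⟩ := banach_steinhaus
    (g := fun n => NormedSpace.inclusionInDoubleDual ℂ (Hs s) (ψ n)) fun f => by
      obtain ⟨C, hC⟩ := (hψ.tendsto_apply (fun _ => 0) f).norm.bddAbove_range
      refine ⟨C, fun n => ?_⟩
      have := hC (Set.mem_range_self n)
      simpa [translate_zero] using this
  refine ⟨C, fun n => ?_⟩
  rw [← (NormedSpace.inclusionInDoubleDualLi (E := Hs s) ℂ).norm_map (ψ n)]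
  exact hC n

lemma norm_toL2_le (u : Hs s) : ‖toL2 u‖ ≤ ‖u‖ := by
  rw [← Lp.norm_fourier_eq (toL2 u)]
  refine Lp.norm_le_norm_of_ae_le (g := weightedFourier u) ?_
  filter_upwards [weightedFourier_ae u] with ξ hξ
  rw [hξ, norm_mul, Complex.norm_real, Real.norm_of_nonneg (weight_pos s ξ).le]
  refine le_mul_of_one_le_left (norm_nonneg _) (Real.one_le_sqrt.2 ?_)
  linarith [Real.rpow_nonneg (abs_nonneg (2 * Real.pi * ξ)) (2 * s)]

lemma lintegral_weight_sq (u : Hs s) :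
    ∫⁻ ξ, ENNReal.ofReal (weight s ξ ^ 2) *
      ‖(𝓕 (toL2 u) : Lp ℂ 2 (volume : Measure ℝ)) ξ‖ₑ ^ (2 : ℝ) = ENNReal.ofReal (‖u‖ ^ 2) := by
  have h : ‖u‖ = ‖weightedFourier u‖ := rfl
  rw [h, ← lintegral_enorm_sq_eq]
  refine lintegral_congr_ae ?_
  filter_upwards [weightedFourier_ae u] with ξ hξ
  rw [hξ, enorm_mul, ENNReal.mul_rpow_of_nonneg _ _ two_pos.le, ← ofReal_norm (weight s ξ : ℂ),
    Complex.norm_real, Real.norm_of_nonneg (weight_pos s ξ).le,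
    ENNReal.ofReal_rpow_of_nonneg (weight_pos s ξ).le two_pos.le, Real.rpow_two]

/-- The functional `u ↦ ∫_S 𝓕 u` on `H^s` for a set `S` of frequencies of finite measure. -/
def integralFourier {S : Set ℝ} (hS : MeasurableSet S) (hSv : volume S ≠ ⊤) :
    StrongDual ℂ (Hs s) :=
  (innerSL ℂ (indicatorConstLp 2 hS hSv (1 : ℂ))).comp
    ((Lp.fourierTransformₗᵢ ℝ ℂ).toContinuousLinearEquiv.toContinuousLinearMap.comp
      (toL2.mkContinuous 1 fun u => by simpa using norm_toL2_le u))

lemma integralFourier_apply {S : Set ℝ} (hS : MeasurableSet S) (hSv : volume S ≠ ⊤) (u : Hs s) :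
    integralFourier hS hSv u = ∫ ξ in S, (𝓕 (toL2 u) : Lp ℂ 2 (volume : Measure ℝ)) ξ :=
  L2.inner_indicatorConstLp_one hS hSv _

/-- Translating by `-x` multiplies the transform by the character in the inversion integral at `x`.
Evaluation at every point thus reduces to a single functional. -/
lemma freqRestrict_ae_eq_integralFourier {S : Set ℝ} (hS : MeasurableSet S) (hSv : volume S ≠ ⊤)
    (u : Hs s) :
    freqRestrict hS (toL2 u) =ᵐ[volume] fun x => integralFourier hS hSv (translate (-x) u) := by
  filter_upwards [freqRestrict_ae hS (toL2 u) hSv] with x hx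
  rw [hx, integralFourier_apply]
  refine integral_congr_ae (ae_restrict_of_ae ?_)
  filter_upwards [fourier_translateL2_ae (-x) (toL2 u)] with ξ hξ
  refine Eq.trans ?_ hξ.symm
  simp

lemma IsVanishing.eventually_norm_freqRestrict_le {ψ : ℕ → Hs s} (hψ : IsVanishing ψ) {S : Set ℝ}
    (hS : MeasurableSet S) (hSv : volume S ≠ ⊤) {η : ℝ} (hη : 0 < η) :
    ∀ᶠ n in atTop, ∀ᵐ x, ‖freqRestrict hS (toL2 (ψ n)) x‖ ≤ η := by
  have key : ∀ᶠ n in atTop, ∀ x, ‖integralFourier hS hSv (translate x (ψ n))‖ ≤ η := by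
    by_contra h
    -- For each `n` a translation violating the bound is selected whenever one exists (`0`
    -- otherwise). Vanishing along this one sequence rules out violations at every point for large
    -- `n`.
    have hx : ∀ n, ∃ x, (∃ y, η < ‖integralFourier hS hSv (translate y (ψ n))‖) →
        η < ‖integralFourier hS hSv (translate x (ψ n))‖ := by
      intro n
      by_cases hy : ∃ y, η < ‖integralFourier hS hSv (translate y (ψ n))‖
      · exact ⟨hy.choose, fun _ => hy.choose_spec⟩
      · exact ⟨0, fun h => absurd h hy⟩
    choose x hx using hx
    refine h ?_
    have hlim := (hψ.tendsto_apply x (integralFourier hS hSv)).norm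
    rw [norm_zero] at hlim
    filter_upwards [hlim.eventually_lt_const hη] with n hn y
    by_contra! hy
    exact lt_asymm hn (hx n ⟨y, hy⟩)
  filter_upwards [key] with n hn
  filter_upwards [freqRestrict_ae_eq_integralFourier hS hSv (ψ n)] with x hx
  rw [hx]
  exact hn _

end Hs

/-! ### Sobolev embedding and conclusion -/

lemma abs_le_weight_sq {s ξ : ℝ} (hs : 1 / 2 ≤ s) (hξ : 1 ≤ |ξ|) : |ξ| ≤ weight s ξ ^ 2 := by
  have h1 : |ξ| ≤ |2 * Real.pi * ξ| := by
    rw [abs_mul, abs_of_pos Real.two_pi_pos]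
    exact le_mul_of_one_le_left (abs_nonneg _) (by linarith [Real.pi_gt_three])
  have h2 := Real.self_le_rpow_of_one_le (hξ.trans h1) (y := 2 * s) (by linarith)
  rw [weight_sq]
  linarith

lemma abs_rpow_le_weight_sq {s ξ r : ℝ} (hs : 1 / 2 ≤ s) (hr0 : 0 ≤ r) (hr1 : r ≤ 1) :
    |ξ| ^ r ≤ weight s ξ ^ 2 := by
  rcases le_total 1 |ξ| with h | h
  · exact (Real.rpow_le_self_of_one_le h hr1).trans (abs_le_weight_sq hs h)
  · rw [weight_sq]
    linarith [Real.rpow_le_one (abs_nonneg ξ) h hr0,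
      Real.rpow_nonneg (abs_nonneg (2 * Real.pi * ξ)) (2 * s)]

lemma eLpNorm_ofReal_le {f : ℝ → ℂ} {p c : ℝ} (hp : 0 < p)
    (h : ∫⁻ x, ‖f x‖ₑ ^ p ≤ ENNReal.ofReal c) :
    eLpNorm f (ENNReal.ofReal p) volume ≤ ENNReal.ofReal c ^ (1 / p) := by
  rw [eLpNorm_eq_lintegral_rpow_enorm_toReal (by simpa using hp) ENNReal.ofReal_ne_top,
    ENNReal.toReal_ofReal hp.le]
  exact ENNReal.rpow_le_rpow h (by positivity)

namespace Hs

variable {s : ℝ}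

/-- The Sobolev embedding `H^s ⊆ L^p` for `s ≥ 1/2` and `2 < p < ∞`. -/
lemma memLp (hs : 1 / 2 ≤ s) {p : ℝ} (hp : 2 < p) (u : Hs s) :
    MemLp (u : ℝ → ℂ) (ENNReal.ofReal p) volume := by
  have hp0 : 0 < p := by linarith
  -- The `+ 1` keeps `K` positive even when `u = 0`.
  refine ⟨Lp.aestronglyMeasurable _, lt_of_le_of_lt (eLpNorm_ofReal_le hp0
    (lintegral_rpow_le_of_fourier (toL2 u) hp (K := ‖u‖ ^ 2 + 1) (by positivity) ?_))
    (ENNReal.rpow_lt_top_of_nonneg (by positivity) ENNReal.ofReal_ne_top)⟩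
  refine le_trans (lintegral_mono fun ξ => ?_) ((lintegral_weight_sq u).le.trans
    (ENNReal.ofReal_le_ofReal (by linarith)))
  have : 2 / p ≤ 1 := (div_le_one hp0).2 hp.le
  gcongr
  exact abs_rpow_le_weight_sq hs (by linarith) (by linarith [show 0 < 2 / p by positivity])

/-- The exponent `1 - 2/p` is below `1` by `2/p`; on `|ξ| > R` this surplus yields `R^(-2/p)`, which
becomes `R⁻¹` after the power `p/2`. -/
lemma eLpNorm_freqRestrict_compl_le (hs : 1 / 2 ≤ s) {p R B : ℝ} (hp : 2 < p) (hR : 1 ≤ R)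
    (hB : 0 < B) {u : Hs s} (hu : ‖u‖ ^ 2 ≤ B) (hS : MeasurableSet {ξ : ℝ | |ξ| ≤ R}) :
    eLpNorm (freqRestrict hS.compl (toL2 u)) (ENNReal.ofReal p) volume ≤
      ENNReal.ofReal (sobolevConst p * B ^ (p / 2) * R⁻¹) ^ (1 / p) := by
  have hp0 : 0 < p := by linarith
  have hR0 : 0 < R := by linarith
  have hc : sobolevConst p * B ^ (p / 2) * R⁻¹ =
      sobolevConst p * (R ^ (-(2 / p)) * B) ^ (p / 2) := by
    rw [Real.mul_rpow (by positivity) hB.le, ← Real.rpow_mul hR0.le,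
      show -(2 / p) * (p / 2) = -1 by field_simp, Real.rpow_neg_one]
    ring
  rw [hc]
  refine eLpNorm_ofReal_le hp0 (lintegral_rpow_le_of_fourier _ hp (by positivity) ?_)
  rw [ENNReal.ofReal_mul (by positivity)]
  refine le_trans ?_ (mul_le_mul_right (ENNReal.ofReal_le_ofReal hu) _)
  rw [← lintegral_weight_sq, ← lintegral_const_mul' _ _ ENNReal.ofReal_ne_top]
  refine lintegral_mono_ae ?_
  filter_upwards [fourier_freqRestrict_ae hS.compl (toL2 u)] with ξ hξ
  rw [hξ]
  by_cases h : ξ ∈ {ξ : ℝ | |ξ| ≤ R}ᶜ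
  · have hRξ : R < |ξ| := not_le.1 h
    rw [Set.indicator_of_mem h, ← mul_assoc, ← ENNReal.ofReal_mul (by positivity)]
    gcongr
    rw [show 1 - 2 / p = -(2 / p) + 1 by ring, Real.rpow_add (hR0.trans hRξ), Real.rpow_one]
    exact mul_le_mul (Real.rpow_le_rpow_of_nonpos hR0 hRξ.le (by simp; positivity))
      (abs_le_weight_sq hs (hR.trans hRξ.le)) (abs_nonneg _) (by positivity)
  · simp [Set.indicator_of_notMem h]

/-- Interpolation between `L²` and `L^∞`: pointwise, the `p`-th power is at most `η^(p-2)` times the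
square. -/
lemma eLpNorm_freqRestrict_le {p η B : ℝ} (hp : 2 < p) (hη : 0 ≤ η) {u : Hs s}
    (hu : ‖u‖ ^ 2 ≤ B) {S : Set ℝ} (hS : MeasurableSet S)
    (hv : ∀ᵐ x, ‖freqRestrict hS (toL2 u) x‖ ≤ η) :
    eLpNorm (freqRestrict hS (toL2 u)) (ENNReal.ofReal p) volume ≤
      ENNReal.ofReal (B * η ^ (p - 2)) ^ (1 / p) := by
  refine eLpNorm_ofReal_le (by linarith) ?_
  have hv2 : ∫⁻ x, ‖freqRestrict hS (toL2 u) x‖ₑ ^ (2 : ℝ) ≤ ENNReal.ofReal B := by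
    rw [lintegral_enorm_sq_freqRestrict]
    refine (setLIntegral_le_lintegral _ _).trans ?_
    rw [lintegral_enorm_sq_fourier, lintegral_enorm_sq_eq]
    exact ENNReal.ofReal_le_ofReal
      ((pow_le_pow_left₀ (norm_nonneg _) (norm_toL2_le u) 2).trans hu)
  rw [mul_comm, ENNReal.ofReal_mul (by positivity)]
  refine le_trans ?_ (mul_le_mul_right hv2 _)
  rw [← lintegral_const_mul' _ _ ENNReal.ofReal_ne_top]
  refine lintegral_mono_ae ?_
  filter_upwards [hv] with x hx
  calc _ = ‖freqRestrict hS (toL2 u) x‖ₑ ^ (p - 2) * ‖freqRestrict hS (toL2 u) x‖ₑ ^ (2 : ℝ) := by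
        rw [← ENNReal.rpow_add_of_nonneg _ _ (by linarith) two_pos.le, sub_add_cancel]
    _ ≤ _ := by
        rw [← ENNReal.ofReal_rpow_of_nonneg hη (by linarith), ← ofReal_norm]
        gcongr

lemma IsVanishing.tendsto_eLpNorm (hs : 1 / 2 ≤ s) {ψ : ℕ → Hs s} (hψ : IsVanishing ψ) {p : ℝ}
    (hp : 2 < p) : Tendsto (fun n => eLpNorm (ψ n : ℝ → ℂ) (ENNReal.ofReal p) volume)
      atTop (𝓝 0) := by
  refine ENNReal.tendsto_nhds_zero.2 fun ε hε => ?_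
  have hp0 : 0 < p := by linarith
  obtain ⟨C, hC⟩ := hψ.exists_norm_le
  set B := C ^ 2 + 1 with hBdef
  have hB : 0 < B := by positivity
  have hψB : ∀ n, ‖ψ n‖ ^ 2 ≤ B := fun n => by
    have := pow_le_pow_left₀ (norm_nonneg _) (hC n) 2
    linarith
  have hε2 : 0 < ε / 2 := ENNReal.half_pos hε.ne'
  have hroot : ∀ {l : Filter ℝ} {f : ℝ → ℝ}, Tendsto f l (𝓝 0) →
      ∀ᶠ r in l, ENNReal.ofReal (f r) ^ (1 / p) ≤ ε / 2 := by
    intro l f hf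
    have h1 := ((ENNReal.continuous_rpow_const (y := 1 / p)).tendsto _).comp
      (ENNReal.tendsto_ofReal hf)
    rw [ENNReal.ofReal_zero, ENNReal.zero_rpow_of_pos (by positivity)] at h1
    exact h1.eventually_le_const hε2
  have hRlim : Tendsto (fun R : ℝ => sobolevConst p * B ^ (p / 2) * R⁻¹) atTop (𝓝 0) := by
    simpa using (tendsto_inv_atTop_zero (𝕜 := ℝ)).const_mul (sobolevConst p * B ^ (p / 2))
  -- `R` is fixed first, independently of `n`; only then is the sup bound `η` chosen and vanishing
  -- invoked on the now fixed frequency band.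
  obtain ⟨R, hR, hR1⟩ := ((hroot hRlim).and (eventually_ge_atTop (1 : ℝ))).exists
  have hη : Tendsto (fun η : ℝ => B * η ^ (p - 2)) (𝓝[>] 0) (𝓝 0) := by
    have h1 : Continuous fun η : ℝ => B * η ^ (p - 2) :=
      (Real.continuous_rpow_const (by linarith)).const_mul B
    have h2 := h1.tendsto 0
    rw [Real.zero_rpow (by linarith), mul_zero] at h2
    exact h2.mono_left nhdsWithin_le_nhds
  obtain ⟨η, hη, hη0⟩ := ((hroot hη).and self_mem_nhdsWithin).exists
  have hS : MeasurableSet {ξ : ℝ | |ξ| ≤ R} := measurableSet_le (by fun_prop) (by fun_prop)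
  have hSv : volume {ξ : ℝ | |ξ| ≤ R} ≠ ⊤ := by
    have : {ξ : ℝ | |ξ| ≤ R} = Set.Icc (-R) R := by ext; simp [abs_le]
    simp [this]
  filter_upwards [hψ.eventually_norm_freqRestrict_le hS hSv hη0] with n hn
  have hadd : (ψ n : ℝ → ℂ) =ᵐ[volume]
      (freqRestrict hS (toL2 (ψ n)) : ℝ → ℂ) + freqRestrict hS.compl (toL2 (ψ n)) := by
    refine EventuallyEq.trans ?_ (Lp.coeFn_add _ _)
    rw [freqRestrict_add_compl]
  rw [eLpNorm_congr_ae hadd]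
  refine (eLpNorm_add_le (Lp.aestronglyMeasurable _) (Lp.aestronglyMeasurable _)
    (ENNReal.one_le_ofReal.2 (by linarith))).trans ?_
  rw [← ENNReal.add_halves ε]
  exact add_le_add ((eLpNorm_freqRestrict_le hp (le_of_lt hη0) (hψB n) hS hn).trans hη)
    ((eLpNorm_freqRestrict_compl_le hs hp hR1 hB (hψB n) hS).trans hR)

end Hs

end

end FracSobolev

theorem mainTheorem8 (s : ℝ) (hs : 1 / 2 ≤ s) (ψ : ℕ → FracSobolev.Hs s)
    (hψ : FracSobolev.Hs.IsVanishing ψ) (p : ℝ) (hp : 2 < p) :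
    (∀ n, MemLp (ψ n : ℝ → ℂ) (ENNReal.ofReal p) (volume : Measure ℝ)) ∧
    Tendsto (fun n => eLpNorm (ψ n : ℝ → ℂ) (ENNReal.ofReal p) (volume : Measure ℝ))
      atTop (𝓝 0) := by
  exact ⟨fun n => FracSobolev.Hs.memLp hs hp (ψ n), hψ.tendsto_eLpNorm hs hp⟩
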